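/- Let $\alpha,b_1,b_2\in\mathbb C$ with $\alpha\neq 0$, and for $b>0$ let \[ A_b=\begin{bmatrix} \alpha & 0 & \overline{b_1}+1 & 0 \\ 0 & \alpha & b & \overline{b_2}+1 \\ b_1-1 & b & -\alpha & 0 \\ 0 & b_2-1 & 0 & -\alpha \end{bmatrix}. \] For a matrix $A\in\mathbb C^{4\times 4}$ let $W(A)=\{\langle Ax,x\rangle : x\in\mathbb C^4,\ \|x\|=1\}$ be its numerical range. Call a subset of $\mathbb C$ bi-elliptical if it is the convex hull of two (non-degenerate) ellipses with distinct centers, neither of which is contained in the elliptical disk bounded by the other. Then there is at most one value $b>0$ for which $W(A_b)$ is bi-elliptical. -/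

import Mathlib

noncomputable section

/-- The numerical range `W(A) = {⟨Ax, x⟩ : ‖x‖ = 1}` of a square complex matrix, for the standard
inner product of `ℂⁿ`. (Mathlib's inner product is conjugate-linear in its first argument.) -/
def numericalRange {n : ℕ} (A : Matrix (Fin n) (Fin n) ℂ) : Set ℂ :=
  {z | ∃ x : EuclideanSpace ℂ (Fin n), ‖x‖ = 1 ∧ inner ℂ x (Matrix.toEuclideanLin A x) = z}

/-- The ellipse in `ℂ` with center `c`, semi-axes `r` and `s`, the first of them in the
direction `exp (i φ)`. -/
def ellipse (c : ℂ) (r s φ : ℝ) : Set ℂ :=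
  {z | ∃ t : ℝ, z = c + Complex.exp (φ * Complex.I) *
    ((r * Real.cos t : ℝ) + (s * Real.sin t : ℝ) * Complex.I)}

/-- `E` is a (non-degenerate) ellipse with center `c`; circles are included. -/
def IsEllipseWithCenter (E : Set ℂ) (c : ℂ) : Prop :=
  ∃ r s φ : ℝ, 0 < r ∧ 0 < s ∧ E = ellipse c r s φ

/-- `S` is bi-elliptical: the convex hull of two ellipses with distinct centers, neither of which
lies in the elliptical disk bounded by the other (otherwise `S` would be an elliptical disk). -/
def IsBiElliptical (S : Set ℂ) : Prop :=
  ∃ (E₁ E₂ : Set ℂ) (c₁ c₂ : ℂ), IsEllipseWithCenter E₁ c₁ ∧ IsEllipseWithCenter E₂ c₂ ∧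
    c₁ ≠ c₂ ∧ ¬ E₁ ⊆ convexHull ℝ E₂ ∧ ¬ E₂ ⊆ convexHull ℝ E₁ ∧
    S = convexHull ℝ (E₁ ∪ E₂)

/-- The matrix with blocks `α I`, `B* + I`, `B - I`, `-α I`, for the upper triangular matrix `B`
with diagonal `b₁, b₂` and real upper right entry `b`. -/
def triangularizedMatrix (α b₁ b₂ : ℂ) (b : ℝ) : Matrix (Fin 4) (Fin 4) ℂ :=
  !![α, 0, star b₁ + 1, 0;
     0, α, (b : ℂ), star b₂ + 1;
     b₁ - 1, (b : ℂ), -α, 0;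
     0, b₂ - 1, 0, -α]

end

/-!
For `w = t + i`, the maximum of `Re (w̄ z)` over `W(A_b)` is `√(E(t) + |t| √Q(t))` with quadratic
polynomials `E` and `Q`, positive at `0`; hence it has a kink at `t = 0`. For the hull of two
ellipses it is `max (L₁ + √R₁) (L₂ + √R₂)` with `Lᵢ` affine and `Rᵢ` quadratic, and
`max (-L₁ + √R₁) (-L₂ + √R₂)` in the direction `-w`, where the value for `W(A_b)` is the same. All
these branches are analytic, so comparing them on the two sides of the kink yields
`E = L₁² + R₁` and `t² Q = 4 L₁² R₁`, that is `Q = 4 κ (E - κ t²)` with a constant `κ > 0`. With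
`s = 1 / t`, `m = 4 κ` and `δ = m - b²` this identity becomes
`(N₁ - N₂)² - 2 δ (N₁ + N₂) + δ² = 4 m (Re α + s Im α)²` for `Nᵢ = |bᵢ + i s|²`, and at most one
pair `(m, δ)` with `m > 0` satisfies it.
-/

open ComplexConjugate Filter Topology

/-! ### Support values -/

/-- `M` is the value at `w` of the support function of `S`, and it is attained: the maximum of
`⟪w, z⟫` over `z ∈ S` is `M`. -/
def IsSupportValue {E : Type*} [NormedAddCommGroup E] [InnerProductSpace ℝ E] (S : Set E) (w : E)
    (M : ℝ) : Prop :=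
  IsGreatest ((fun z => inner ℝ w z) '' S) M

theorem IsSupportValue.union {E : Type*} [NormedAddCommGroup E] [InnerProductSpace ℝ E]
    {S T : Set E} {w : E} {M N : ℝ} (hS : IsSupportValue S w M) (hT : IsSupportValue T w N) :
    IsSupportValue (S ∪ T) w (max M N) := by
  rw [IsSupportValue, Set.image_union]
  exact IsGreatest.union hS hT

theorem IsSupportValue.convexHull {E : Type*} [NormedAddCommGroup E] [InnerProductSpace ℝ E]
    {S : Set E} {w : E} {M : ℝ} (hS : IsSupportValue S w M) :
    IsSupportValue (convexHull ℝ S) w M := by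
  refine ⟨Set.image_mono (subset_convexHull ℝ S) hS.1, ?_⟩
  rintro _ ⟨z, hz, rfl⟩
  exact convexHull_min (fun v hv => hS.2 ⟨v, hv, rfl⟩)
    (convex_halfSpace_le (innerₗ E w).isLinear M) hz

theorem inner_ofReal_add_I (t : ℝ) (z : ℂ) :
    inner ℝ (t + Complex.I) z = t * z.re + z.im := by
  simp [Complex.inner, mul_comm]

/-! ### Ellipses -/

theorem mul_add_mul_le_sqrt_mul {a b x y r : ℝ} (hr : 0 ≤ r) (h : x ^ 2 + y ^ 2 = r ^ 2) :
    a * x + b * y ≤ √(a ^ 2 + b ^ 2) * r := by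
  refine le_of_abs_le (abs_le_of_sq_le_sq ?_ (by positivity))
  rw [mul_pow, Real.sq_sqrt (by positivity), ← h]
  linarith [sq_nonneg (a * y - b * x)]

theorem isGreatest_range_mul_cos_add_mul_sin (a b : ℝ) :
    IsGreatest (Set.range fun t : ℝ => a * Real.cos t + b * Real.sin t) √(a ^ 2 + b ^ 2) := by
  constructor
  · have hnorm : ‖(⟨a, b⟩ : ℂ)‖ = √(a ^ 2 + b ^ 2) := by
      rw [Complex.norm_def, Complex.normSq_mk, sq, sq]
    have hcos := Complex.norm_mul_cos_arg ⟨a, b⟩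
    have hsin := Complex.norm_mul_sin_arg ⟨a, b⟩
    rw [hnorm] at hcos hsin
    refine ⟨Complex.arg ⟨a, b⟩, ?_⟩
    linear_combination -Real.cos (Complex.arg ⟨a, b⟩) * hcos -
      Real.sin (Complex.arg ⟨a, b⟩) * hsin +
      √(a ^ 2 + b ^ 2) * Real.sin_sq_add_cos_sq (Complex.arg ⟨a, b⟩)
  · rintro _ ⟨t, rfl⟩
    simpa using mul_add_mul_le_sqrt_mul (a := a) (b := b) zero_le_one
      (by rw [Real.cos_sq_add_sin_sq, one_pow] : Real.cos t ^ 2 + Real.sin t ^ 2 = 1 ^ 2)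

/-- The quadratic form whose square root is the support function of an ellipse with semi-axes
`r` and `s`, the first in the direction `exp (i φ)`, centered at the origin. -/
noncomputable def ellipseForm (r s φ : ℝ) (w : ℂ) : ℝ :=
  (r * inner ℝ w (Complex.exp (φ * Complex.I))) ^ 2 +
    (s * inner ℝ w (Complex.exp (φ * Complex.I) * Complex.I)) ^ 2

theorem ellipseForm_neg (r s φ : ℝ) (w : ℂ) : ellipseForm r s φ (-w) = ellipseForm r s φ w := by
  simp only [ellipseForm, inner_neg_left, mul_neg, neg_sq]

theorem inner_sq_add_inner_mul_I_sq (w z : ℂ) :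
    inner ℝ w z ^ 2 + inner ℝ w (z * Complex.I) ^ 2 = (‖w‖ * ‖z‖) ^ 2 := by
  simp only [mul_pow, Complex.inner, Complex.sq_norm, Complex.normSq_apply]
  simp only [Complex.mul_re, Complex.conj_re, Complex.conj_im, mul_neg, sub_neg_eq_add,
    Complex.I_re, mul_zero, Complex.I_im, mul_one, zero_sub, neg_mul, Complex.mul_im, add_zero]
  ring

theorem ellipseForm_pos {r s φ : ℝ} (hr : 0 < r) (hs : 0 < s) {w : ℂ} (hw : w ≠ 0) :
    0 < ellipseForm r s φ w := by
  have hsum := inner_sq_add_inner_mul_I_sq w (Complex.exp (φ * Complex.I))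
  rw [Complex.norm_exp_ofReal_mul_I, mul_one] at hsum
  unfold ellipseForm
  by_cases h : inner ℝ w (Complex.exp (φ * Complex.I)) = 0
  · rw [h, zero_pow two_ne_zero, zero_add] at hsum
    rw [mul_pow s, hsum]
    positivity
  · positivity

theorem analyticAt_ellipseForm (r s φ x : ℝ) :
    AnalyticAt ℝ (fun t : ℝ => ellipseForm r s φ (t + Complex.I)) x := by
  simp only [ellipseForm, inner_ofReal_add_I]
  fun_prop

theorem isSupportValue_ellipse (c w : ℂ) (r s φ : ℝ) :
    IsSupportValue (ellipse c r s φ) w (inner ℝ w c + √(ellipseForm r s φ w)) := by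
  set e := Complex.exp (φ * Complex.I)
  have hval (t : ℝ) : inner ℝ w (c + e * ((r * Real.cos t : ℝ) + (s * Real.sin t : ℝ) *
      Complex.I)) = inner ℝ w c +
      (r * inner ℝ w e * Real.cos t + s * inner ℝ w (e * Complex.I) * Real.sin t) := by
    have : e * ((r * Real.cos t : ℝ) + (s * Real.sin t : ℝ) * Complex.I) =
        (r * Real.cos t) • e + (s * Real.sin t) • (e * Complex.I) := by
      simp only [Complex.real_smul]
      ring
    rw [this, inner_add_right, inner_add_right, real_inner_smul_right, real_inner_smul_right]
    ring
  obtain ⟨⟨t, ht⟩, hle⟩ := isGreatest_range_mul_cos_add_mul_sin (r * inner ℝ w e)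
    (s * inner ℝ w (e * Complex.I))
  constructor
  · exact ⟨_, ⟨t, rfl⟩, (hval t).trans (congrArg _ ht)⟩
  · rintro _ ⟨_, ⟨t, rfl⟩, rfl⟩
    exact (hval t).trans_le (add_le_add_right (hle ⟨t, rfl⟩) _)

/-! ### The numerical range -/

theorem isSupportValue_numericalRange {n : ℕ} {A : Matrix (Fin n) (Fin n) ℂ} {w : ℂ} {μ : ℝ}
    (hle : ∀ x, inner ℝ w (inner ℂ x (Matrix.toEuclideanLin A x)) ≤ μ * ‖x‖ ^ 2)
    {x : EuclideanSpace ℂ (Fin n)} (hx : x ≠ 0)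
    (heq : inner ℝ w (inner ℂ x (Matrix.toEuclideanLin A x)) = μ * ‖x‖ ^ 2) :
    IsSupportValue (numericalRange A) w μ := by
  constructor
  · have hnorm : ‖x‖ ≠ 0 := norm_ne_zero_iff.2 hx
    refine ⟨_, ⟨((‖x‖⁻¹ : ℝ) : ℂ) • x, ?_, rfl⟩, ?_⟩
    · rw [norm_smul, Complex.norm_real, norm_inv, norm_norm, inv_mul_cancel₀ hnorm]
    · simp only [map_smul, inner_smul_left, inner_smul_right, Complex.conj_ofReal,
        ← Complex.real_smul, heq]
      field_simp
  · rintro _ ⟨_, ⟨x, hx, rfl⟩, rfl⟩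
    simpa [hx] using hle x

section BlockForm

variable {E F : Type*} [NormedAddCommGroup E] [InnerProductSpace ℂ E] [NormedAddCommGroup F]
  [InnerProductSpace ℂ F]

/-- The quadratic form of the Hermitian operator with blocks `a I`, `C`, `C*`, `-a I` on
`E × F`. -/
noncomputable def blockForm (a : ℝ) (C : F →ₗ[ℂ] E) (y : E) (z : F) : ℝ :=
  a * (‖y‖ ^ 2 - ‖z‖ ^ 2) + 2 * (inner ℂ y (C z)).re

theorem blockForm_le (a : ℝ) {C : F →ₗ[ℂ] E} {k : ℝ} (hC : ∀ z, ‖C z‖ ≤ k * ‖z‖) (y : E) (z : F) :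
    blockForm a C y z ≤ √(a ^ 2 + k ^ 2) * (‖y‖ ^ 2 + ‖z‖ ^ 2) :=
  calc blockForm a C y z
    _ ≤ a * (‖y‖ ^ 2 - ‖z‖ ^ 2) + 2 * (‖y‖ * (k * ‖z‖)) := by
        unfold blockForm
        gcongr
        exact (re_inner_le_norm (𝕜 := ℂ) y (C z)).trans (by gcongr; exact hC z)
    _ = a * (‖y‖ ^ 2 - ‖z‖ ^ 2) + k * (2 * ‖y‖ * ‖z‖) := by ring
    _ ≤ √(a ^ 2 + k ^ 2) * (‖y‖ ^ 2 + ‖z‖ ^ 2) :=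
        mul_add_mul_le_sqrt_mul (by positivity) (by ring)

theorem exists_blockForm_eq (a : ℝ) {C : F →ₗ[ℂ] E} {k : ℝ} (hk : 0 < k) {z : F} (hz : z ≠ 0)
    (hCz : ‖C z‖ = k * ‖z‖) :
    ∃ (y : E) (z' : F), y ≠ 0 ∧
      blockForm a C y z' = √(a ^ 2 + k ^ 2) * (‖y‖ ^ 2 + ‖z'‖ ^ 2) := by
  have hμ : √(a ^ 2 + k ^ 2) ^ 2 = a ^ 2 + k ^ 2 := Real.sq_sqrt (by positivity)
  set μ := √(a ^ 2 + k ^ 2)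
  refine ⟨C z, ((μ - a : ℝ) : ℂ) • z, ?_, ?_⟩
  · rw [← norm_ne_zero_iff, hCz]
    positivity
  · have hinner : (inner ℂ (C z) (C (((μ - a : ℝ) : ℂ) • z))).re = (μ - a) * ‖C z‖ ^ 2 := by
      rw [map_smul, inner_smul_right, inner_self_eq_norm_sq_to_K, Complex.re_ofReal_mul]
      norm_cast
    rw [blockForm, hinner, norm_smul, Complex.norm_real, mul_pow, Real.norm_eq_abs, sq_abs, hCz]
    linear_combination (a - μ) * ‖z‖ ^ 2 * hμ

end BlockForm

/-- The largest eigenvalue of a Hermitian `2 × 2` matrix with diagonal `p, q` and off-diagonal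
entries of modulus `r`. -/
noncomputable def topEigenvalue (p q r : ℝ) : ℝ :=
  (p + q) / 2 + √(((p - q) / 2) ^ 2 + r ^ 2)

section TopEigenvalue

variable (p q r : ℝ)

theorem topEigenvalue_sub_mul_sub :
    (topEigenvalue p q r - p) * (topEigenvalue p q r - q) = r ^ 2 := by
  have := Real.sq_sqrt (by positivity : 0 ≤ ((p - q) / 2) ^ 2 + r ^ 2)
  unfold topEigenvalue
  linear_combination this

theorem le_topEigenvalue_left : p ≤ topEigenvalue p q r := by
  have := Real.le_sqrt_of_sq_le (le_add_of_nonneg_right (sq_nonneg r) :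
    ((p - q) / 2) ^ 2 ≤ ((p - q) / 2) ^ 2 + r ^ 2)
  unfold topEigenvalue
  linarith

theorem le_topEigenvalue_right : q ≤ topEigenvalue p q r := by
  have := Real.abs_le_sqrt (le_add_of_nonneg_right (sq_nonneg r) :
    ((p - q) / 2) ^ 2 ≤ ((p - q) / 2) ^ 2 + r ^ 2)
  have := neg_le_abs ((p - q) / 2)
  have := le_abs_self ((p - q) / 2)
  unfold topEigenvalue
  linarith

end TopEigenvalue

/-- The Hermitian form `p |z₀|² + q |z₁|² + 2 Re (z̄₀ g z₁)` on `ℂ²`. -/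
noncomputable def hermitianForm (p q : ℝ) (g : ℂ) (z : EuclideanSpace ℂ (Fin 2)) : ℝ :=
  p * ‖z 0‖ ^ 2 + q * ‖z 1‖ ^ 2 + 2 * (conj (z 0) * g * z 1).re

theorem hermitianForm_le (p q : ℝ) (g : ℂ) (z : EuclideanSpace ℂ (Fin 2)) :
    hermitianForm p q g z ≤ topEigenvalue p q ‖g‖ * ‖z‖ ^ 2 := by
  have hmul := topEigenvalue_sub_mul_sub p q ‖g‖
  have hp := sub_nonneg.2 (le_topEigenvalue_left p q ‖g‖)
  have hq := sub_nonneg.2 (le_topEigenvalue_right p q ‖g‖)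
  set l := topEigenvalue p q ‖g‖
  have hre : (conj (z 0) * g * z 1).re ≤ ‖z 0‖ * ‖g‖ * ‖z 1‖ := by
    simpa only [norm_mul, Complex.norm_conj] using Complex.re_le_norm (conj (z 0) * g * z 1)
  have hamgm : 2 * (‖z 0‖ * ‖g‖ * ‖z 1‖) ≤ (l - p) * ‖z 0‖ ^ 2 + (l - q) * ‖z 1‖ ^ 2 := by
    refine le_of_abs_le (abs_le_of_sq_le_sq ?_ (by positivity))
    linear_combination sq_nonneg ((l - p) * ‖z 0‖ ^ 2 - (l - q) * ‖z 1‖ ^ 2) -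
      4 * ‖z 0‖ ^ 2 * ‖z 1‖ ^ 2 * hmul
  rw [hermitianForm, EuclideanSpace.norm_sq_eq, Fin.sum_univ_two]
  linarith

theorem exists_hermitianForm_eq (p q : ℝ) (g : ℂ) :
    ∃ z ≠ 0, hermitianForm p q g z = topEigenvalue p q ‖g‖ * ‖z‖ ^ 2 := by
  have hmul := topEigenvalue_sub_mul_sub p q ‖g‖
  set l := topEigenvalue p q ‖g‖
  by_cases hl : l = p
  · refine ⟨!₂[1, 0], fun h => by simpa using congrArg (· 0) h, ?_⟩
    simp [hermitianForm, EuclideanSpace.norm_sq_eq, hl]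
  · refine ⟨!₂[g, (l - p : ℝ)], fun h => ?_, ?_⟩
    · exact hl (by simpa [sub_eq_zero, ← Complex.ofReal_sub] using congrArg (· 1) h)
    · have hre : (conj g * g * (l - p : ℝ)).re = ‖g‖ ^ 2 * (l - p) := by
        rw [Complex.conj_mul', ← Complex.ofReal_pow, ← Complex.ofReal_mul, Complex.ofReal_re]
      simp only [hermitianForm, EuclideanSpace.norm_sq_eq, Fin.sum_univ_two,
        Matrix.cons_val_zero, Matrix.cons_val_one, hre, Complex.norm_real, Real.norm_eq_abs, sq_abs]
      linear_combination -(l - p) * hmul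

theorem norm_sq_toEuclideanLin_lowerTriangular (m₁ m₂ β : ℂ) (z : EuclideanSpace ℂ (Fin 2)) :
    ‖Matrix.toEuclideanLin !![m₁, 0; β, m₂] z‖ ^ 2 =
      hermitianForm (‖m₁‖ ^ 2 + ‖β‖ ^ 2) (‖m₂‖ ^ 2) (conj β * m₂) z := by
  simp only [hermitianForm, EuclideanSpace.norm_sq_eq, Fin.sum_univ_two, Complex.sq_norm,
    Complex.normSq_apply, Matrix.toLpLin_apply, Matrix.mulVec, dotProduct]
  simp only [Matrix.of_apply, Matrix.cons_val', Matrix.cons_val_zero, Matrix.cons_val_fin_one,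
    Matrix.cons_val_one, zero_mul, add_zero, Complex.mul_re, Complex.mul_im, Complex.add_re,
    Complex.add_im, Complex.conj_re, Complex.conj_im, neg_mul, sub_neg_eq_add]
  ring

/-- For `A = triangularizedMatrix α b₁ b₂ b`, the upper right `2 × 2` block of the Hermitian part
of `w̄ A`. -/
noncomputable def offDiagonalBlock (b₁ b₂ : ℂ) (b : ℝ) (w : ℂ) : Matrix (Fin 2) (Fin 2) ℂ :=
  !![w.re * conj b₁ - w.im * Complex.I, 0; (w.re * b : ℝ), w.re * conj b₂ - w.im * Complex.I]

theorem inner_triangularizedMatrix (α b₁ b₂ : ℂ) (b : ℝ) (w : ℂ) (x : EuclideanSpace ℂ (Fin 4)) :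
    inner ℝ w (inner ℂ x (Matrix.toEuclideanLin (triangularizedMatrix α b₁ b₂ b) x)) =
      blockForm (inner ℝ w α) (Matrix.toEuclideanLin (offDiagonalBlock b₁ b₂ b w))
        !₂[x 0, x 1] !₂[x 2, x 3] := by
  simp only [blockForm, offDiagonalBlock, triangularizedMatrix, EuclideanSpace.norm_sq_eq,
    PiLp.inner_apply, Matrix.toLpLin_apply, Matrix.mulVec, dotProduct, Fin.sum_univ_two,
    Fin.sum_univ_four, Complex.sq_norm, Complex.normSq_apply, Complex.inner]
  simp only [RCLike.star_def, Matrix.of_apply, Matrix.cons_val', Matrix.cons_val_zero,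
    Matrix.cons_val_fin_one, Matrix.cons_val_one, zero_mul, add_zero, Matrix.cons_val,
    RCLike.inner_apply, zero_add, neg_mul, Complex.mul_re, Complex.add_re, Complex.conj_re,
    Complex.one_re, Complex.add_im, Complex.conj_im, Complex.one_im, sub_neg_eq_add, Complex.mul_im,
    mul_neg, Complex.ofReal_re, Complex.ofReal_im, sub_zero, Complex.sub_re, Complex.sub_im,
    Complex.neg_re, neg_sub, Complex.neg_im, neg_add_rev, Complex.ofReal_mul, neg_zero,
    Complex.I_re, mul_zero, Complex.I_im, mul_one, sub_self]
  ring

/-- The square of the operator norm of `offDiagonalBlock b₁ b₂ b w`. -/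
noncomputable def offDiagonalNormSq (b₁ b₂ : ℂ) (b : ℝ) (w : ℂ) : ℝ :=
  topEigenvalue (‖w.re * b₁ + w.im * Complex.I‖ ^ 2 + (w.re * b) ^ 2)
    (‖w.re * b₂ + w.im * Complex.I‖ ^ 2) (|w.re * b| * ‖w.re * b₂ + w.im * Complex.I‖)

section OffDiagonalBlock

variable (b₁ b₂ : ℂ) (b : ℝ)

theorem offDiagonalNormSq_neg (w : ℂ) :
    offDiagonalNormSq b₁ b₂ b (-w) = offDiagonalNormSq b₁ b₂ b w := by
  have hnorm (z : ℂ) : ‖-(w.re * z) + -(w.im * Complex.I)‖ = ‖w.re * z + w.im * Complex.I‖ := by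
    rw [← neg_add, norm_neg]
  simp only [offDiagonalNormSq, neg_sq, Complex.neg_re, Complex.neg_im, Complex.ofReal_neg,
    neg_mul, abs_neg, hnorm]

theorem offDiagonalNormSq_pos {b : ℝ} (hb : b ≠ 0) {w : ℂ} (hw : w ≠ 0) :
    0 < offDiagonalNormSq b₁ b₂ b w := by
  refine lt_of_lt_of_le ?_ (le_topEigenvalue_left _ _ _)
  by_cases hre : w.re = 0
  · have him : w.im ≠ 0 := fun him => hw (Complex.ext hre him)
    simpa [hre] using (by positivity : 0 < w.im ^ 2)
  · positivity

theorem norm_mul_conj_sub_mul_I (c s : ℝ) (z : ℂ) :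
    ‖c * conj z - s * Complex.I‖ = ‖c * z + s * Complex.I‖ := by
  rw [← Complex.norm_conj]
  simp

theorem norm_sq_offDiagonalBlock (w : ℂ) (z : EuclideanSpace ℂ (Fin 2)) :
    ‖Matrix.toEuclideanLin (offDiagonalBlock b₁ b₂ b w) z‖ ^ 2 =
      hermitianForm (‖w.re * b₁ + w.im * Complex.I‖ ^ 2 + (w.re * b) ^ 2)
        (‖w.re * b₂ + w.im * Complex.I‖ ^ 2)
        ((w.re * b : ℝ) * (w.re * conj b₂ - w.im * Complex.I)) z := by
  rw [offDiagonalBlock, norm_sq_toEuclideanLin_lowerTriangular, norm_mul_conj_sub_mul_I,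
    norm_mul_conj_sub_mul_I, Complex.norm_real, Real.norm_eq_abs, sq_abs, Complex.conj_ofReal]

theorem topEigenvalue_eq_offDiagonalNormSq (w : ℂ) :
    topEigenvalue (‖w.re * b₁ + w.im * Complex.I‖ ^ 2 + (w.re * b) ^ 2)
      (‖w.re * b₂ + w.im * Complex.I‖ ^ 2)
      ‖((w.re * b : ℝ) : ℂ) * (w.re * conj b₂ - w.im * Complex.I)‖ =
      offDiagonalNormSq b₁ b₂ b w := by
  rw [norm_mul, norm_mul_conj_sub_mul_I, Complex.norm_real, Real.norm_eq_abs, offDiagonalNormSq]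

theorem norm_offDiagonalBlock_le (w : ℂ) (z : EuclideanSpace ℂ (Fin 2)) :
    ‖Matrix.toEuclideanLin (offDiagonalBlock b₁ b₂ b w) z‖ ≤
      √(offDiagonalNormSq b₁ b₂ b w) * ‖z‖ := by
  have hle := hermitianForm_le (‖w.re * b₁ + w.im * Complex.I‖ ^ 2 + (w.re * b) ^ 2)
    (‖w.re * b₂ + w.im * Complex.I‖ ^ 2)
    ((w.re * b : ℝ) * (w.re * conj b₂ - w.im * Complex.I)) z
  rw [← norm_sq_offDiagonalBlock, topEigenvalue_eq_offDiagonalNormSq] at hle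
  simpa [Real.sqrt_mul'] using Real.le_sqrt_of_sq_le hle

theorem exists_norm_offDiagonalBlock_eq (w : ℂ) :
    ∃ z ≠ 0, ‖Matrix.toEuclideanLin (offDiagonalBlock b₁ b₂ b w) z‖ =
      √(offDiagonalNormSq b₁ b₂ b w) * ‖z‖ := by
  obtain ⟨z, hz, heq⟩ := exists_hermitianForm_eq
    (‖w.re * b₁ + w.im * Complex.I‖ ^ 2 + (w.re * b) ^ 2) (‖w.re * b₂ + w.im * Complex.I‖ ^ 2)
    ((w.re * b : ℝ) * (w.re * conj b₂ - w.im * Complex.I))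
  rw [← norm_sq_offDiagonalBlock, topEigenvalue_eq_offDiagonalNormSq] at heq
  exact ⟨z, hz, by simpa [Real.sqrt_mul'] using congrArg Real.sqrt heq⟩

end OffDiagonalBlock

theorem isSupportValue_numericalRange_triangularizedMatrix (α b₁ b₂ : ℂ) {b : ℝ} (hb : b ≠ 0)
    {w : ℂ} (hw : w ≠ 0) :
    IsSupportValue (numericalRange (triangularizedMatrix α b₁ b₂ b)) w
      √(inner ℝ w α ^ 2 + offDiagonalNormSq b₁ b₂ b w) := by
  have hpos := offDiagonalNormSq_pos b₁ b₂ hb hw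
  have hsplit (x : EuclideanSpace ℂ (Fin 4)) :
      ‖x‖ ^ 2 = ‖!₂[x 0, x 1]‖ ^ 2 + ‖!₂[x 2, x 3]‖ ^ 2 := by
    simp [EuclideanSpace.norm_sq_eq, Fin.sum_univ_four, add_assoc]
  obtain ⟨z₀, hz₀, hC⟩ := exists_norm_offDiagonalBlock_eq b₁ b₂ b w
  obtain ⟨y, z, hy, hyz⟩ := exists_blockForm_eq (inner ℝ w α) (Real.sqrt_pos.2 hpos) hz₀ hC
  have heta (v : EuclideanSpace ℂ (Fin 2)) : !₂[v 0, v 1] = v := by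
    ext i
    fin_cases i <;> rfl
  rw [← Real.sq_sqrt hpos.le]
  refine isSupportValue_numericalRange (x := !₂[y 0, y 1, z 0, z 1]) (fun x => ?_)
    (fun hx => hy ?_) ?_
  · rw [inner_triangularizedMatrix, hsplit]
    exact blockForm_le _ (norm_offDiagonalBlock_le b₁ b₂ b w) _ _
  · rw [← heta y]
    simpa using And.intro (congrArg (· 0) hx) (congrArg (· 1) hx)
  · rw [inner_triangularizedMatrix, hsplit]
    simpa [heta] using hyz

/-! ### Matching the branches at a kink -/

theorem eventuallyEq_or_of_frequently_max_eq {f₁ f₂ g : ℝ → ℝ} {x : ℝ} (h₁ : AnalyticAt ℝ f₁ x)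
    (h₂ : AnalyticAt ℝ f₂ x) (hg : AnalyticAt ℝ g x)
    (h : ∃ᶠ t in 𝓝[≠] x, max (f₁ t) (f₂ t) = g t) : f₁ =ᶠ[𝓝 x] g ∨ f₂ =ᶠ[𝓝 x] g := by
  have hor : ∃ᶠ t in 𝓝[≠] x, f₁ t = g t ∨ f₂ t = g t :=
    h.mono fun t ht => (max_choice (f₁ t) (f₂ t)).imp (·.symm.trans ht) (·.symm.trans ht)
  exact (frequently_or_distrib.1 hor).imp (h₁.frequently_eq_iff_eventually_eq hg).1
    (h₂.frequently_eq_iff_eventually_eq hg).1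

theorem eventuallyEq_branches_of_max_kink {f₁ f₂ g h : ℝ → ℝ} {x : ℝ} (h₁ : AnalyticAt ℝ f₁ x)
    (h₂ : AnalyticAt ℝ f₂ x) (hg : AnalyticAt ℝ g x) (hh : AnalyticAt ℝ h x)
    (hgt : ∀ᶠ t in 𝓝[>] x, max (f₁ t) (f₂ t) = g t)
    (hlt : ∀ᶠ t in 𝓝[<] x, max (f₁ t) (f₂ t) = h t) (hne : ¬ g =ᶠ[𝓝 x] h) :
    f₁ =ᶠ[𝓝 x] g ∧ f₂ =ᶠ[𝓝 x] h ∨ f₂ =ᶠ[𝓝 x] g ∧ f₁ =ᶠ[𝓝 x] h := by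
  have hright := eventuallyEq_or_of_frequently_max_eq h₁ h₂ hg
    (hgt.frequently.filter_mono (nhdsGT_le_nhdsNE x))
  have hleft := eventuallyEq_or_of_frequently_max_eq h₁ h₂ hh
    (hlt.frequently.filter_mono (nhdsLT_le_nhdsNE x))
  rcases hright with hr | hr <;> rcases hleft with hl | hl
  · exact absurd (hr.symm.trans hl) hne
  · exact Or.inl ⟨hr, hl⟩
  · exact Or.inr ⟨hr, hl⟩
  · exact absurd (hr.symm.trans hl) hne

theorem analyticAt_sqrt_comp {f : ℝ → ℝ} {x : ℝ} (hf : AnalyticAt ℝ f x) (hx : f x ≠ 0) :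
    AnalyticAt ℝ (fun t => √(f t)) x :=
  (Real.contDiffAt_sqrt hx).analyticAt.comp hf

/-- The analytic continuation, from the side of `0` where `t` has the sign `ε = ± 1`, of
`√(E t + |t| √(Q t))`. -/
noncomputable def kinkBranch (E Q : ℝ → ℝ) (ε t : ℝ) : ℝ :=
  √(E t + ε * t * √(Q t))

section KinkBranch

variable {E Q : ℝ → ℝ}

theorem analyticAt_kinkBranch (hE : AnalyticAt ℝ E 0) (hQ : AnalyticAt ℝ Q 0) (hE₀ : 0 < E 0)
    (hQ₀ : 0 < Q 0) (ε : ℝ) : AnalyticAt ℝ (kinkBranch E Q ε) 0 := by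
  have hsqrt := analyticAt_sqrt_comp hQ hQ₀.ne'
  exact analyticAt_sqrt_comp (by fun_prop) (by simpa using hE₀.ne')

theorem eventually_nonneg_kinkBranch (hE : ContinuousAt E 0) (hQ : ContinuousAt Q 0)
    (hE₀ : 0 < E 0) (ε : ℝ) : ∀ᶠ t in 𝓝 0, 0 ≤ E t + ε * t * √(Q t) := by
  have hcont : ContinuousAt (fun t => E t + ε * t * √(Q t)) 0 := by fun_prop
  exact (hcont.eventually_const_lt (by simpa using hE₀)).mono fun t ht => ht.le

theorem not_kinkBranch_eventuallyEq (hE : ContinuousAt E 0) (hQ : ContinuousAt Q 0)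
    (hE₀ : 0 < E 0) (hQ₀ : 0 < Q 0) : ¬ kinkBranch E Q 1 =ᶠ[𝓝 0] kinkBranch E Q (-1) := by
  intro h
  have hzero : ∀ᶠ t in 𝓝[≠] (0 : ℝ), t = 0 := by
    refine Eventually.filter_mono nhdsWithin_le_nhds ?_
    filter_upwards [h, hQ.eventually_const_lt hQ₀, eventually_nonneg_kinkBranch hE hQ hE₀ 1,
      eventually_nonneg_kinkBranch hE hQ hE₀ (-1)] with t ht hQt hp hm
    have hmul : t * √(Q t) = 0 := by linarith [(Real.sqrt_inj hp hm).1 ht]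
    exact (mul_eq_zero.1 hmul).resolve_right (Real.sqrt_pos.2 hQt).ne'
  obtain ⟨t, ht, hne⟩ := (hzero.and self_mem_nhdsWithin).exists
  exact hne ht

end KinkBranch

theorem eq_sq_add_and_sq_eq_of_sqrt_eq {L R E D : ℝ} (hR : 0 ≤ R) (hp : 0 ≤ E + D)
    (hm : 0 ≤ E - D) (h₁ : L + √R = √(E + D)) (h₂ : -L + √R = √(E - D)) :
    E = L ^ 2 + R ∧ D ^ 2 = 4 * L ^ 2 * R := by
  have hsqR := Real.sq_sqrt hR
  have hsqp := Real.sq_sqrt hp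
  have hsqm := Real.sq_sqrt hm
  rw [← h₁] at hsqp
  rw [← h₂] at hsqm
  have hD : D = 2 * L * √R := by linear_combination (hsqm - hsqp) / 2
  refine ⟨by linear_combination hsqR - (hsqp + hsqm) / 2, ?_⟩
  rw [hD, mul_pow, hsqR]
  ring

theorem eventually_eq_sq_add_and_sq_mul_eq {L R E Q : ℝ → ℝ} {ε : ℝ} (hε : ε ^ 2 = 1)
    (hR : ContinuousAt R 0) (hE : ContinuousAt E 0) (hQ : ContinuousAt Q 0) (hR₀ : 0 < R 0)
    (hE₀ : 0 < E 0) (hQ₀ : 0 < Q 0)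
    (h₁ : (fun t => L t + √(R t)) =ᶠ[𝓝 0] kinkBranch E Q ε)
    (h₂ : (fun t => -L t + √(R t)) =ᶠ[𝓝 0] kinkBranch E Q (-ε)) :
    ∀ᶠ t in 𝓝 0, E t = L t ^ 2 + R t ∧ t ^ 2 * Q t = 4 * L t ^ 2 * R t := by
  filter_upwards [h₁, h₂, hR.eventually_const_lt hR₀, hQ.eventually_const_lt hQ₀,
    eventually_nonneg_kinkBranch hE hQ hE₀ ε, eventually_nonneg_kinkBranch hE hQ hE₀ (-ε)]
    with t ht₁ ht₂ hRt hQt hp hm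
  simp only [kinkBranch, neg_mul, ← sub_eq_add_neg] at ht₁ ht₂ hm
  obtain ⟨hEt, hD⟩ := eq_sq_add_and_sq_eq_of_sqrt_eq hRt.le hp hm ht₁ ht₂
  refine ⟨hEt, ?_⟩
  rw [← hD, mul_pow, mul_pow, hε, Real.sq_sqrt hQt.le, one_mul]

theorem eventuallyEq_kinkBranch_of_max_eq {f₁ f₂ E Q : ℝ → ℝ} (h₁ : AnalyticAt ℝ f₁ 0)
    (h₂ : AnalyticAt ℝ f₂ 0) (hE : AnalyticAt ℝ E 0) (hQ : AnalyticAt ℝ Q 0) (hE₀ : 0 < E 0)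
    (hQ₀ : 0 < Q 0) (h : ∀ t, max (f₁ t) (f₂ t) = √(E t + |t| * √(Q t))) :
    f₁ =ᶠ[𝓝 0] kinkBranch E Q 1 ∧ f₂ =ᶠ[𝓝 0] kinkBranch E Q (-1) ∨
      f₂ =ᶠ[𝓝 0] kinkBranch E Q 1 ∧ f₁ =ᶠ[𝓝 0] kinkBranch E Q (-1) := by
  refine eventuallyEq_branches_of_max_kink h₁ h₂ (analyticAt_kinkBranch hE hQ hE₀ hQ₀ 1)
    (analyticAt_kinkBranch hE hQ hE₀ hQ₀ (-1)) ?_ ?_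
    (not_kinkBranch_eventuallyEq hE.continuousAt hQ.continuousAt hE₀ hQ₀)
  · filter_upwards [self_mem_nhdsWithin] with t ht
    rw [h, kinkBranch, one_mul, abs_of_pos ht]
  · filter_upwards [self_mem_nhdsWithin] with t ht
    rw [h, kinkBranch, neg_one_mul, abs_of_neg ht]

theorem eventually_eq_sq_add_and_sq_mul_eq_of_max_eq {L₁ L₂ R₁ R₂ E Q : ℝ → ℝ}
    (hL₁ : AnalyticAt ℝ L₁ 0) (hL₂ : AnalyticAt ℝ L₂ 0) (hR₁ : AnalyticAt ℝ R₁ 0)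
    (hR₂ : AnalyticAt ℝ R₂ 0) (hE : AnalyticAt ℝ E 0) (hQ : AnalyticAt ℝ Q 0) (hR₁₀ : 0 < R₁ 0)
    (hR₂₀ : 0 < R₂ 0) (hE₀ : 0 < E 0) (hQ₀ : 0 < Q 0) (hne : ¬ L₁ =ᶠ[𝓝 0] L₂)
    (hpos : ∀ t, max (L₁ t + √(R₁ t)) (L₂ t + √(R₂ t)) = √(E t + |t| * √(Q t)))
    (hneg : ∀ t, max (-L₁ t + √(R₁ t)) (-L₂ t + √(R₂ t)) = √(E t + |t| * √(Q t))) :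
    ∀ᶠ t in 𝓝 0, E t = L₁ t ^ 2 + R₁ t ∧ t ^ 2 * Q t = 4 * L₁ t ^ 2 * R₁ t := by
  have hsqrt₁ := analyticAt_sqrt_comp hR₁ hR₁₀.ne'
  have hsqrt₂ := analyticAt_sqrt_comp hR₂ hR₂₀.ne'
  have hsame {v₁ v₂ : ℝ → ℝ} (h₁ : L₁ + (fun t => √(R₁ t)) =ᶠ[𝓝 0] v₁)
      (h₂ : L₂ + (fun t => √(R₂ t)) =ᶠ[𝓝 0] v₂) (h₁' : -L₁ + (fun t => √(R₁ t)) =ᶠ[𝓝 0] v₁)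
      (h₂' : -L₂ + (fun t => √(R₂ t)) =ᶠ[𝓝 0] v₂) : L₁ =ᶠ[𝓝 0] L₂ := by
    filter_upwards [h₁.trans h₁'.symm, h₂.trans h₂'.symm] with t ht₁ ht₂
    simp only [Pi.add_apply, Pi.neg_apply] at ht₁ ht₂
    linarith
  have hopp {ε : ℝ} (hε : ε ^ 2 = 1) (h₁ : L₁ + (fun t => √(R₁ t)) =ᶠ[𝓝 0] kinkBranch E Q ε)
      (h₁' : -L₁ + (fun t => √(R₁ t)) =ᶠ[𝓝 0] kinkBranch E Q (-ε)) :=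
    eventually_eq_sq_add_and_sq_mul_eq hε hR₁.continuousAt hE.continuousAt hQ.continuousAt hR₁₀
      hE₀ hQ₀ h₁ h₁'
  rcases eventuallyEq_kinkBranch_of_max_eq (hL₁.add hsqrt₁) (hL₂.add hsqrt₂) hE hQ hE₀ hQ₀ hpos
    with ⟨h₁, h₂⟩ | ⟨h₂, h₁⟩ <;>
  rcases eventuallyEq_kinkBranch_of_max_eq (hL₁.neg.add hsqrt₁) (hL₂.neg.add hsqrt₂) hE hQ hE₀ hQ₀
    hneg with ⟨h₁', h₂'⟩ | ⟨h₂', h₁'⟩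
  · exact absurd (hsame h₁ h₂ h₁' h₂') hne
  · exact hopp (one_pow 2) h₁ h₁'
  · exact hopp neg_one_sq h₁ (by rwa [neg_neg])
  · exact absurd (hsame h₁ h₂ h₁' h₂') hne

theorem affine_not_eventuallyEq {p₁ q₁ p₂ q₂ x : ℝ} (h : ¬ (p₁ = p₂ ∧ q₁ = q₂)) :
    ¬ (fun t => p₁ * t + q₁) =ᶠ[𝓝 x] fun t => p₂ * t + q₂ := by
  intro heq
  have hglobal (t : ℝ) : p₁ * t + q₁ = p₂ * t + q₂ :=
    congrFun (AnalyticOnNhd.eq_of_eventuallyEq (𝕜 := ℝ) (fun t _ => by fun_prop)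
      (fun t _ => by fun_prop) heq) t
  have h₀ := hglobal 0
  have h₁ := hglobal 1
  exact h ⟨by linarith, by linarith⟩

theorem exists_pos_eq_four_mul_of_affine {p q : ℝ} {R E Q : ℝ → ℝ} (hE : AnalyticOnNhd ℝ E Set.univ)
    (hQ : AnalyticOnNhd ℝ Q Set.univ) (hR₀ : R 0 ≠ 0) (hQ₀ : Q 0 ≠ 0)
    (h : ∀ᶠ t in 𝓝 0, E t = (p * t + q) ^ 2 + R t ∧
      t ^ 2 * Q t = 4 * (p * t + q) ^ 2 * R t) :
    ∃ κ > 0, ∀ t, Q t = 4 * κ * (E t - κ * t ^ 2) := by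
  have hq : q = 0 := by simpa [hR₀] using h.self_of_nhds.2
  have hnear : ∀ᶠ t in 𝓝[≠] 0, Q t = 4 * p ^ 2 * (E t - p ^ 2 * t ^ 2) := by
    filter_upwards [h.filter_mono nhdsWithin_le_nhds, self_mem_nhdsWithin] with t ht hne
    refine mul_left_cancel₀ (pow_ne_zero 2 hne) ?_
    rw [ht.2, ht.1, hq]
    ring
  have hglobal (t : ℝ) : Q t = 4 * p ^ 2 * (E t - p ^ 2 * t ^ 2) :=
    congrFun (hQ.eq_of_frequently_eq (fun t _ => by have := hE t trivial; fun_prop)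
      hnear.frequently) t
  have hp : p ≠ 0 := by
    rintro rfl
    exact hQ₀ (by simpa using hglobal 0)
  exact ⟨p ^ 2, by positivity, hglobal⟩

/-! ### The family of matrices -/

/-- The mean of the squares of the eigenvalues of the Hermitian part of `w̄ A`, for `w = t + i` and
`A = triangularizedMatrix α b₁ b₂ b`. -/
noncomputable def eigenvalueSqMean (α b₁ b₂ : ℂ) (b t : ℝ) : ℝ :=
  (t * α.re + α.im) ^ 2 +
    (‖t * b₁ + Complex.I‖ ^ 2 + ‖t * b₂ + Complex.I‖ ^ 2 + (t * b) ^ 2) / 2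

/-- With `w` and `A` as for `eigenvalueSqMean`, the squares of the eigenvalues of the Hermitian part
of `w̄ A` differ from their mean by `± |t| √(eigenvalueSqGap b₁ b₂ b t)`. -/
noncomputable def eigenvalueSqGap (b₁ b₂ : ℂ) (b t : ℝ) : ℝ :=
  (t * (‖b₁‖ ^ 2 - ‖b₂‖ ^ 2 + b ^ 2) / 2 + (b₁.im - b₂.im)) ^ 2 +
    (b * ‖t * b₂ + Complex.I‖) ^ 2

theorem norm_mul_add_I_sq (t : ℝ) (z : ℂ) :
    ‖t * z + Complex.I‖ ^ 2 = t ^ 2 * ‖z‖ ^ 2 + 2 * t * z.im + 1 := by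
  simp only [Complex.sq_norm, Complex.normSq_apply]
  simp only [Complex.add_re, Complex.mul_re, Complex.ofReal_re, Complex.ofReal_im, zero_mul,
    sub_zero, Complex.I_re, add_zero, Complex.add_im, Complex.mul_im, Complex.I_im]
  ring

theorem inner_sq_add_offDiagonalNormSq (α b₁ b₂ : ℂ) (b t : ℝ) :
    inner ℝ (t + Complex.I) α ^ 2 + offDiagonalNormSq b₁ b₂ b (t + Complex.I) =
      eigenvalueSqMean α b₁ b₂ b t + |t| * √(eigenvalueSqGap b₁ b₂ b t) := by
  have hgap : ((‖t * b₁ + Complex.I‖ ^ 2 + (t * b) ^ 2 - ‖t * b₂ + Complex.I‖ ^ 2) / 2) ^ 2 +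
      (|t * b| * ‖t * b₂ + Complex.I‖) ^ 2 = t ^ 2 * eigenvalueSqGap b₁ b₂ b t := by
    simp only [eigenvalueSqGap, mul_pow, sq_abs, norm_mul_add_I_sq]
    ring
  rw [inner_ofReal_add_I, eigenvalueSqMean, ← Real.sqrt_sq_eq_abs,
    ← Real.sqrt_mul (sq_nonneg t), ← hgap]
  simp only [offDiagonalNormSq, topEigenvalue, Complex.add_re, Complex.add_im, Complex.ofReal_re,
    Complex.ofReal_im, Complex.I_re, Complex.I_im, add_zero, zero_add, Complex.ofReal_one, one_mul]
  ring

theorem analyticOnNhd_eigenvalueSqMean (α b₁ b₂ : ℂ) (b : ℝ) :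
    AnalyticOnNhd ℝ (eigenvalueSqMean α b₁ b₂ b) Set.univ := by
  intro t _
  unfold eigenvalueSqMean
  simp only [norm_mul_add_I_sq]
  fun_prop

theorem analyticOnNhd_eigenvalueSqGap (b₁ b₂ : ℂ) (b : ℝ) :
    AnalyticOnNhd ℝ (eigenvalueSqGap b₁ b₂ b) Set.univ := by
  intro t _
  unfold eigenvalueSqGap
  simp only [mul_pow, norm_mul_add_I_sq]
  fun_prop

theorem eigenvalueSqMean_zero_pos (α b₁ b₂ : ℂ) (b : ℝ) : 0 < eigenvalueSqMean α b₁ b₂ b 0 := by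
  have : 0 < α.im ^ 2 + 1 := by positivity
  simpa [eigenvalueSqMean] using this

theorem eigenvalueSqGap_zero_pos (b₁ b₂ : ℂ) {b : ℝ} (hb : b ≠ 0) :
    0 < eigenvalueSqGap b₁ b₂ b 0 := by
  have : 0 < (b₁.im - b₂.im) ^ 2 + b ^ 2 := by positivity
  simpa [eigenvalueSqGap] using this

theorem isSupportValue_convexHull_ellipse_union (c₁ c₂ w : ℂ) (r₁ s₁ φ₁ r₂ s₂ φ₂ : ℝ) :
    IsSupportValue (convexHull ℝ (ellipse c₁ r₁ s₁ φ₁ ∪ ellipse c₂ r₂ s₂ φ₂)) w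
      (max (inner ℝ w c₁ + √(ellipseForm r₁ s₁ φ₁ w))
        (inner ℝ w c₂ + √(ellipseForm r₂ s₂ φ₂ w))) :=
  ((isSupportValue_ellipse c₁ w r₁ s₁ φ₁).union
    (isSupportValue_ellipse c₂ w r₂ s₂ φ₂)).convexHull

theorem max_eq_of_numericalRange_eq {α b₁ b₂ c₁ c₂ : ℂ} {b r₁ s₁ φ₁ r₂ s₂ φ₂ : ℝ} (hb : b ≠ 0)
    (hW : numericalRange (triangularizedMatrix α b₁ b₂ b) =
      convexHull ℝ (ellipse c₁ r₁ s₁ φ₁ ∪ ellipse c₂ r₂ s₂ φ₂)) {w : ℂ} (hw : w ≠ 0) :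
    max (inner ℝ w c₁ + √(ellipseForm r₁ s₁ φ₁ w)) (inner ℝ w c₂ + √(ellipseForm r₂ s₂ φ₂ w)) =
      √(inner ℝ w α ^ 2 + offDiagonalNormSq b₁ b₂ b w) :=
  IsGreatest.unique (isSupportValue_convexHull_ellipse_union c₁ c₂ w r₁ s₁ φ₁ r₂ s₂ φ₂)
    (hW ▸ isSupportValue_numericalRange_triangularizedMatrix α b₁ b₂ hb hw)

theorem IsBiElliptical.exists_eigenvalueSqGap_eq {α b₁ b₂ : ℂ} {b : ℝ} (hb : b ≠ 0)
    (h : IsBiElliptical (numericalRange (triangularizedMatrix α b₁ b₂ b))) :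
    ∃ κ > 0, ∀ t, eigenvalueSqGap b₁ b₂ b t =
      4 * κ * (eigenvalueSqMean α b₁ b₂ b t - κ * t ^ 2) := by
  obtain ⟨_, _, c₁, c₂, ⟨r₁, s₁, φ₁, hr₁, hs₁, rfl⟩, ⟨r₂, s₂, φ₂, hr₂, hs₂, rfl⟩, hc, _, _, hW⟩ := h
  have hne (t : ℝ) : (t + Complex.I : ℂ) ≠ 0 := fun h => by simpa using congrArg Complex.im h
  have hpos (t : ℝ) := max_eq_of_numericalRange_eq hb hW (hne t)
  have hneg (t : ℝ) := max_eq_of_numericalRange_eq hb hW (neg_ne_zero.2 (hne t))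
  simp only [inner_neg_left, ellipseForm_neg, offDiagonalNormSq_neg, neg_sq] at hneg
  simp only [inner_sq_add_offDiagonalNormSq] at hpos hneg
  have hform₁ := ellipseForm_pos (φ := φ₁) hr₁ hs₁ (hne 0)
  have hform₂ := ellipseForm_pos (φ := φ₂) hr₂ hs₂ (hne 0)
  have hmean := analyticOnNhd_eigenvalueSqMean α b₁ b₂ b
  have hgap := analyticOnNhd_eigenvalueSqGap b₁ b₂ b
  have hgap₀ := eigenvalueSqGap_zero_pos b₁ b₂ hb
  refine exists_pos_eq_four_mul_of_affine hmean hgap hform₁.ne' hgap₀.ne'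
    (eventually_eq_sq_add_and_sq_mul_eq_of_max_eq (L₁ := fun t => c₁.re * t + c₁.im)
      (L₂ := fun t => c₂.re * t + c₂.im) (by fun_prop) (by fun_prop)
      (analyticAt_ellipseForm r₁ s₁ φ₁ 0) (analyticAt_ellipseForm r₂ s₂ φ₂ 0) (hmean 0 trivial)
      (hgap 0 trivial) hform₁ hform₂ (eigenvalueSqMean_zero_pos α b₁ b₂ b) hgap₀
      (affine_not_eventuallyEq fun h => hc (Complex.ext h.1 h.2)) ?_ ?_)
  · simpa only [inner_ofReal_add_I, mul_comm] using hpos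
  · simpa only [inner_ofReal_add_I, mul_comm] using hneg

/-! ### Uniqueness of the parameters -/

/-- The relation `eigenvalueSqGap = 4 κ (eigenvalueSqMean - κ t²)`, rewritten in the variable
`s = 1 / t` with the parameters `m = 4 κ` and `δ = m - b²`. -/
def DiscriminantIdentity (α b₁ b₂ : ℂ) (m δ : ℝ) : Prop :=
  ∀ s : ℝ, (‖b₁ + s * Complex.I‖ ^ 2 - ‖b₂ + s * Complex.I‖ ^ 2) ^ 2 -
    2 * δ * (‖b₁ + s * Complex.I‖ ^ 2 + ‖b₂ + s * Complex.I‖ ^ 2) + δ ^ 2 =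
    4 * m * (α.re + s * α.im) ^ 2

theorem norm_add_mul_I_sq (s : ℝ) (z : ℂ) :
    ‖z + s * Complex.I‖ ^ 2 = z.re ^ 2 + (z.im + s) ^ 2 := by
  simp only [Complex.sq_norm, Complex.normSq_apply]
  simp only [Complex.add_re, Complex.mul_re, Complex.ofReal_re, Complex.I_re, mul_zero,
    Complex.ofReal_im, Complex.I_im, mul_one, sub_self, add_zero, Complex.add_im, Complex.mul_im]
  ring

theorem discriminantIdentity_of_eigenvalueSqGap_eq {α b₁ b₂ : ℂ} {b κ : ℝ}
    (h : ∀ t, eigenvalueSqGap b₁ b₂ b t =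
      4 * κ * (eigenvalueSqMean α b₁ b₂ b t - κ * t ^ 2)) :
    DiscriminantIdentity α b₁ b₂ (4 * κ) (4 * κ - b ^ 2) := by
  intro s
  simp only [eigenvalueSqGap, eigenvalueSqMean, mul_pow, norm_mul_add_I_sq] at h
  simp only [Complex.sq_norm, Complex.normSq_apply] at h
  simp only [norm_add_mul_I_sq]
  -- `s² f(1 / s)` for a polynomial `f` of degree at most two, in terms of its values at `0, ± 1`
  linear_combination 4 * (s ^ 2 * h 0 + s * (h 1 - h (-1)) / 2 + (h 1 + h (-1)) / 2 - h 0)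

namespace DiscriminantIdentity

variable {α b₁ b₂ : ℂ} {m δ m' δ' : ℝ}

theorem eq_im_sub_im_sq_sub (h : DiscriminantIdentity α b₁ b₂ m δ) :
    δ = (b₁.im - b₂.im) ^ 2 - m * α.im ^ 2 := by
  have h₀ := h 0
  have h₁ := h 1
  have h₂ := h (-1)
  simp only [norm_add_mul_I_sq] at h₀ h₁ h₂
  linear_combination h₀ / 4 - (h₁ + h₂) / 8

theorem im_sq_mul_eq (h : DiscriminantIdentity α b₁ b₂ m δ)
    (h' : DiscriminantIdentity α b₁ b₂ m' δ') (hm : m ≠ m') (s : ℝ) :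
    α.im ^ 2 * (2 * (‖b₁ + s * Complex.I‖ ^ 2 + ‖b₂ + s * Complex.I‖ ^ 2) - (δ + δ')) =
      4 * (α.re + s * α.im) ^ 2 := by
  have hδ : δ - δ' = (m' - m) * α.im ^ 2 := by
    linear_combination h.eq_im_sub_im_sq_sub - h'.eq_im_sub_im_sq_sub
  refine mul_left_cancel₀ (sub_ne_zero.2 hm) ?_
  linear_combination h s - h' s - (δ + δ' - 2 * (‖b₁ + s * Complex.I‖ ^ 2 +
    ‖b₂ + s * Complex.I‖ ^ 2)) * hδ

theorem im_ne_zero (h : DiscriminantIdentity α b₁ b₂ m δ)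
    (h' : DiscriminantIdentity α b₁ b₂ m' δ') (hm : m ≠ m') (hα : α ≠ 0) : α.im ≠ 0 := by
  intro him
  exact hα (Complex.ext (by simpa [him] using h.im_sq_mul_eq h' hm 0) him)

theorem two_mul_re_eq (h : DiscriminantIdentity α b₁ b₂ m δ)
    (h' : DiscriminantIdentity α b₁ b₂ m' δ') (hm : m ≠ m') (hα : α ≠ 0) :
    2 * α.re = α.im * (b₁.im + b₂.im) := by
  have h₁ := h.im_sq_mul_eq h' hm 1
  have h₂ := h.im_sq_mul_eq h' hm (-1)
  simp only [norm_add_mul_I_sq] at h₁ h₂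
  refine mul_left_cancel₀ (h.im_ne_zero h' hm hα) ?_
  linear_combination (h₂ - h₁) / 8

theorem centered (h : DiscriminantIdentity α b₁ b₂ m δ)
    (hα : 2 * α.re = α.im * (b₁.im + b₂.im)) (u : ℝ) :
    (b₁.re ^ 2 - b₂.re ^ 2 + 2 * (b₁.im - b₂.im) * u) ^ 2 -
      2 * δ * (b₁.re ^ 2 + b₂.re ^ 2 + (b₁.im - b₂.im) ^ 2 / 2 + 2 * u ^ 2) + δ ^ 2 =
      4 * m * (α.im * u) ^ 2 := by
  have hu := h (u - (b₁.im + b₂.im) / 2)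
  have hre : α.re = α.im * (b₁.im + b₂.im) / 2 := by linear_combination hα / 2
  simp only [norm_add_mul_I_sq, hre] at hu
  linear_combination hu

theorem left_unique (h : DiscriminantIdentity α b₁ b₂ m δ)
    (h' : DiscriminantIdentity α b₁ b₂ m' δ') (hα : α ≠ 0) (hm : 0 < m) (hm' : 0 < m') :
    m = m' := by
  by_contra hne
  have him := h.im_ne_zero h' hne hα
  have hre := h.two_mul_re_eq h' hne hα
  have hδ := h.eq_im_sub_im_sq_sub
  have hδ' := h'.eq_im_sub_im_sq_sub
  have hlt : δ < (b₁.im - b₂.im) ^ 2 := by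
    rw [hδ]
    exact sub_lt_self _ (by positivity)
  have hlt' : δ' < (b₁.im - b₂.im) ^ 2 := by
    rw [hδ']
    exact sub_lt_self _ (by positivity)
  have hδne : δ ≠ δ' := fun heq =>
    hne (mul_right_cancel₀ (pow_ne_zero 2 him) (by linarith : m * α.im ^ 2 = m' * α.im ^ 2))
  have hsum : δ + δ' = 2 * (b₁.re ^ 2 + b₂.re ^ 2) + (b₁.im - b₂.im) ^ 2 := by
    refine mul_left_cancel₀ (sub_ne_zero.2 hδne) ?_
    linear_combination h.centered hre 0 - h'.centered hre 0
  have him_ne : b₁.im - b₂.im ≠ 0 := by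
    intro hd
    rw [hd, zero_pow two_ne_zero] at hsum hlt hlt'
    linarith [sq_nonneg b₁.re, sq_nonneg b₂.re]
  have hre_sq : b₁.re ^ 2 - b₂.re ^ 2 = 0 := by
    refine mul_left_cancel₀ him_ne ?_
    linear_combination (h.centered hre 1 - h.centered hre (-1)) / 8
  have hprod : δ * δ' = 0 := by
    linear_combination δ * hsum - h.centered hre 0 + (b₁.re ^ 2 - b₂.re ^ 2) * hre_sq
  rcases mul_eq_zero.1 hprod with hzero | hzero <;>
    linarith [sq_nonneg b₁.re, sq_nonneg b₂.re]

theorem unique (h : DiscriminantIdentity α b₁ b₂ m δ)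
    (h' : DiscriminantIdentity α b₁ b₂ m' δ') (hα : α ≠ 0) (hm : 0 < m) (hm' : 0 < m') :
    m = m' ∧ δ = δ' := by
  have heq := h.left_unique h' hα hm hm'
  refine ⟨heq, ?_⟩
  rw [h.eq_im_sub_im_sq_sub, h'.eq_im_sub_im_sq_sub, heq]

end DiscriminantIdentity

theorem corollary4p3 (α b₁ b₂ : ℂ) (hα : α ≠ 0) (b b' : ℝ) (hb : 0 < b) (hb' : 0 < b')
    (h : IsBiElliptical (numericalRange (triangularizedMatrix α b₁ b₂ b)))
    (h' : IsBiElliptical (numericalRange (triangularizedMatrix α b₁ b₂ b'))) :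
    b = b' := by
  obtain ⟨κ, hκ, hgap⟩ := h.exists_eigenvalueSqGap_eq hb.ne'
  obtain ⟨κ', hκ', hgap'⟩ := h'.exists_eigenvalueSqGap_eq hb'.ne'
  obtain ⟨hm, hδ⟩ := (discriminantIdentity_of_eigenvalueSqGap_eq hgap).unique
    (discriminantIdentity_of_eigenvalueSqGap_eq hgap') hα (by positivity) (by positivity)
  exact (pow_left_inj₀ hb.le hb'.le two_ne_zero).1 (by linarith)
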